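/- For $Q\in\mathbb{N}$, $Q\ge 1$, and a prime $p$, let $\mathcal{F}_{Q,p}$ be the set of rationals $\frac{a}{q}\in[0,1]$ in lowest terms with $1\le q\le Q$ and $p\nmid q$. For an integer $k\ge 1$ let $$N_{Q,p}(k)=\#\left\{\frac{a_1}{q_1}<\frac{a_2}{q_2}\text{ consecutive in }\mathcal{F}_{Q,p} : q_1a_2-a_1q_2=k\right\}$$ (the fractions being written in lowest terms), and let $\rho_p(k)=\rho_{Q,p}(k)=N_{Q,p}(k)/\#\mathcal{F}_{Q,p}$. Then for every prime $p$ and every integer $Q\ge 2$, $$\rho_p(1)=1-\frac{2}{3p}+O\left(\frac{\log^2Q}{Q}\right),\qquad \rho_p(k)=\frac{8}{p}\cdot\frac{1}{k(k+1)(k+2)}+O\left(\frac{\log^2Q}{Q}\right)\quad\text{for every integer }k\ge 2,$$ where the implied constants are absolute (independent of $p$, $k$ and $Q$). -/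

import Mathlib

/-- The Farey fractions of order `Q`: the rationals in `[0, 1]` whose denominator in lowest terms
is at most `Q`. (`x.den` is the positive denominator of `x` in lowest terms.) -/
def farey (Q : ℕ) : Set ℚ :=
  {x : ℚ | 0 ≤ x ∧ x ≤ 1 ∧ x.den ≤ Q}

/-- The Farey fractions of order `Q` whose reduced denominator is not divisible by `p`. -/
def fareyPrimeTo (Q p : ℕ) : Set ℚ :=
  {x : ℚ | x ∈ farey Q ∧ ¬ p ∣ x.den}

/-- `x < y` are consecutive elements of the set `S`. -/
def AreConsecutive (S : Set ℚ) (x y : ℚ) : Prop :=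
  x ∈ S ∧ y ∈ S ∧ x < y ∧ ∀ z ∈ S, ¬ (x < z ∧ z < y)

/-- The determinant `q₁ a₂ - a₁ q₂` of two fractions `a₁ / q₁`, `a₂ / q₂` in lowest terms. -/
def fareyDet (x y : ℚ) : ℤ :=
  (x.den : ℤ) * y.num - x.num * (y.den : ℤ)

/-- The pairs of consecutive elements of `fareyPrimeTo Q p` with determinant `k`. -/
def fareyPairs (Q p k : ℕ) : Set (ℚ × ℚ) :=
  {r : ℚ × ℚ | AreConsecutive (fareyPrimeTo Q p) r.1 r.2 ∧ fareyDet r.1 r.2 = (k : ℤ)}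

theorem farey_finite (Q : ℕ) : (farey Q).Finite := by
  refine Set.Finite.subset (((Finset.Icc (0 : ℤ) Q ×ˢ Finset.range (Q + 1)).image
    (fun r : ℤ × ℕ => (r.1 : ℚ) / (r.2 : ℚ))).finite_toSet) ?_
  rintro x ⟨h0, h1, hQ⟩
  have hn : x.num ≤ x.den := by
    have h := Rat.num_div_den x
    have hd : (0 : ℚ) < x.den := by exact_mod_cast x.den_pos
    rw [← h, div_le_one hd] at h1
    exact_mod_cast h1
  have hp : 0 ≤ x.num := Rat.num_nonneg.mpr h0
  simp only [Finset.coe_image, Set.mem_image, Finset.mem_coe, Finset.mem_product, Finset.mem_Icc,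
    Finset.mem_range, Prod.exists]
  exact ⟨x.num, x.den, ⟨⟨hp, by omega⟩, by omega⟩, Rat.num_div_den x⟩

theorem fareyPrimeTo_finite (Q p : ℕ) : (fareyPrimeTo Q p).Finite :=
  (farey_finite Q).subset fun _ hx => hx.1

theorem fareyPairs_finite (Q p k : ℕ) : (fareyPairs Q p k).Finite :=
  ((fareyPrimeTo_finite Q p).prod (fareyPrimeTo_finite Q p)).subset
    fun _ hr => ⟨hr.1.1, hr.1.2.1⟩

/-- The proportion `N_{Q,p}(k) / #F_{Q,p}`: the number of pairs of consecutive elements with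
determinant `k`, divided by the number of fractions (both sets are finite, as shown above). -/
noncomputable def fareyRho (Q p k : ℕ) : ℝ :=
  ((fareyPairs Q p k).ncard : ℝ) / ((fareyPrimeTo Q p).ncard : ℝ)

/-! Let `x < y` be consecutive among the fractions with denominator prime to `p`, with determinant
at least 2. The Farey successor `z` of `x` then lies strictly between them, so `p ∣ z.den`. Its own
successor has determinant 1 with `z`, hence denominator prime to `p`, hence equals `y`. So exactly
one Farey fraction was deleted between `x` and `y`.

Put `q = z.den` and `m = x.den`. Then `q * fareyDet x y = m + y.den`, and `y.den` lies in `(Q - q,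
Q]`, so the determinant is `⌊(Q + m) / q⌋`. Pairs with determinant at least `j ≥ 2` thus correspond
to coprime `(q, m)` with `p ∣ q`, `Q - q < m ≤ Q` and `j q ≤ Q + m` (`ncard_fareyPairsGE`).

For fixed `q` the admissible `m` fill an interval, so their number is `φ(q)/q` times its length up
to `O(d(q))`. With `c = 1/ζ(2)`, the sum of `φ(q)/q` over multiples of `p` up to `x` is `c x / (p +
1) + O(log Q)`, uniformly in `p`; partial summation gives `2 c Q² / ((p + 1) j (j + 1))` pairs.
There are `c p Q² / (2 (p + 1))` fractions to leading order, so the proportion with determinant at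
least `j` is `4 / (p j (j + 1))`. Differencing in `j` gives the case `k ≥ 2`; for `k = 1` subtract
the proportion at `j = 2` from the total. The error obtained is in fact `O(log Q / Q)`. -/

/-! ### Coprime integers in an interval. -/

open ArithmeticFunction in
theorem card_filter_coprime_Ioc_zero {q : ℕ} (hq : 0 < q) (n : ℕ) :
    (((Finset.Ioc 0 n).filter (fun m => Nat.Coprime q m)).card : ℝ) =
      ∑ d ∈ q.divisors, (moebius d : ℝ) * ((n / d : ℕ) : ℝ) := by
  have key : ∀ m ∈ Finset.Ioc 0 n, (if Nat.Coprime q m then (1 : ℝ) else 0) =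
      ∑ d ∈ q.divisors, if d ∣ m then (moebius d : ℝ) else 0 := by
    intro m hm
    have h := congrArg (fun f : ArithmeticFunction ℝ => f (Nat.gcd q m))
      (coe_moebius_mul_coe_zeta (R := ℝ))
    simp only [coe_mul_zeta_apply, one_apply, intCoe_apply] at h
    simp only [Nat.coprime_iff_gcd_eq_one]
    rw [← h, ← Finset.sum_filter]
    refine Finset.sum_congr ?_ fun _ _ => rfl
    ext d
    simp only [Nat.mem_divisors, Finset.mem_filter, Nat.dvd_gcd_iff]
    have : Nat.gcd q m ≠ 0 := (Nat.gcd_pos_of_pos_left m hq).ne'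
    constructor
    · rintro ⟨h, -⟩; exact ⟨⟨h.1, hq.ne'⟩, h.2⟩
    · rintro ⟨h, h2⟩; exact ⟨⟨h.1, h2⟩, this⟩
  rw [Finset.card_filter]
  push_cast
  rw [Finset.sum_congr rfl key, Finset.sum_comm]
  refine Finset.sum_congr rfl fun d _ => ?_
  rw [← Finset.sum_filter, Finset.sum_const, Nat.Ioc_filter_dvd_card_eq_div, nsmul_eq_mul, mul_comm]

open ArithmeticFunction in
theorem totient_div_eq_sum_moebius {q : ℕ} (hq : 0 < q) :
    (q.totient : ℝ) / q = ∑ d ∈ q.divisors, (moebius d : ℝ) / d := by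
  have h := card_filter_coprime_Ioc_zero hq q
  have h2 : ((Finset.Ioc 0 q).filter (fun m => Nat.Coprime q m)).card = q.totient := by
    rw [← Nat.filter_coprime_Ico_eq_totient q 1]
    congr 2
    ext; simp; omega
  have hq' : (q : ℝ) ≠ 0 := by exact_mod_cast hq.ne'
  rw [← h2, h, Finset.sum_div]
  refine Finset.sum_congr rfl fun d hd => ?_
  have hd' := Nat.dvd_of_mem_divisors hd
  have hd0 : (d : ℝ) ≠ 0 := by
    have := Nat.pos_of_mem_divisors hd
    exact_mod_cast this.ne'
  rw [Nat.cast_div hd' hd0]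
  field_simp

theorem abs_natCast_div_sub_le (A B d : ℕ) :
    |((B / d : ℕ) : ℝ) - ((A / d : ℕ) : ℝ) - ((B : ℝ) - A) / d| ≤ 1 := by
  rcases Nat.eq_zero_or_pos d with rfl | hd
  · simp
  have h1 := Nat.div_add_mod A d
  have h2 := Nat.div_add_mod B d
  have h3 := Nat.mod_lt A hd
  have h4 := Nat.mod_lt B hd
  have e1 : (d : ℝ) * (A / d : ℕ) + (A % d : ℕ) = A := by exact_mod_cast h1
  have e2 : (d : ℝ) * (B / d : ℕ) + (B % d : ℕ) = B := by exact_mod_cast h2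
  have e3 : ((A % d : ℕ) : ℝ) < d := by exact_mod_cast h3
  have e4 : ((B % d : ℕ) : ℝ) < d := by exact_mod_cast h4
  have e5 : (0 : ℝ) ≤ (A % d : ℕ) := by positivity
  have e6 : (0 : ℝ) ≤ (B % d : ℕ) := by positivity
  have hd' : (0 : ℝ) < d := by exact_mod_cast hd
  have : ((B / d : ℕ) : ℝ) - ((A / d : ℕ) : ℝ) - ((B : ℝ) - A) / d =
      ((A % d : ℕ) - (B % d : ℕ) : ℝ) / d := by
    field_simp; linarith
  rw [this, abs_div, abs_of_pos hd', div_le_one hd', abs_le]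
  constructor <;> linarith

/-- The number of integers in `(A, B]` coprime to `q` is `(B - A) φ(q) / q` up to `d(q)`. -/
theorem abs_card_filter_coprime_Ioc_sub_le {q : ℕ} (hq : 0 < q) {A B : ℕ} (hAB : A ≤ B) :
    |(((Finset.Ioc A B).filter (fun m => Nat.Coprime q m)).card : ℝ) -
      (q.totient : ℝ) / q * ((B : ℝ) - A)| ≤ q.divisors.card := by
  have hsplit : (((Finset.Ioc 0 B).filter (fun m => Nat.Coprime q m)).card : ℝ) =
      ((Finset.Ioc 0 A).filter (fun m => Nat.Coprime q m)).card +
      ((Finset.Ioc A B).filter (fun m => Nat.Coprime q m)).card := by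
    rw [← Finset.Ioc_union_Ioc_eq_Ioc (Nat.zero_le A) hAB, Finset.filter_union,
      Finset.card_union_of_disjoint]
    · push_cast; rfl
    · refine Finset.disjoint_filter_filter ?_
      rw [Finset.disjoint_left]
      intro a ha hb
      simp only [Finset.mem_Ioc] at ha hb
      omega
  rw [card_filter_coprime_Ioc_zero hq, card_filter_coprime_Ioc_zero hq] at hsplit
  rw [eq_sub_of_add_eq' hsplit.symm, totient_div_eq_sum_moebius hq, Finset.sum_mul,
    ← Finset.sum_sub_distrib, ← Finset.sum_sub_distrib, Finset.card_eq_sum_ones]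
  push_cast
  refine (Finset.abs_sum_le_sum_abs _ _).trans (Finset.sum_le_sum fun d _ => ?_)
  have h1 : |((ArithmeticFunction.moebius d : ℤ) : ℝ)| ≤ 1 := by
    exact_mod_cast ArithmeticFunction.abs_moebius_le_one (n := d)
  have h2 := abs_natCast_div_sub_le A B d
  have : ((ArithmeticFunction.moebius d : ℤ) : ℝ) * ((B / d : ℕ) : ℝ) -
      (ArithmeticFunction.moebius d : ℤ) * ((A / d : ℕ) : ℝ) -
      (ArithmeticFunction.moebius d : ℤ) / d * ((B : ℝ) - A) =
      (ArithmeticFunction.moebius d : ℤ) *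
        (((B / d : ℕ) : ℝ) - ((A / d : ℕ) : ℝ) - ((B : ℝ) - A) / d) := by ring
  rw [this, abs_mul]
  exact mul_le_one₀ h1 (abs_nonneg _) h2

/-! ### Harmonic and divisor sums. -/

theorem sum_Ioc_inv_le (n : ℕ) : ∑ d ∈ Finset.Ioc 0 n, (1 : ℝ) / d ≤ 1 + Real.log n := by
  have h := harmonic_le_one_add_log n
  rw [harmonic_eq_sum_Icc] at h
  push_cast at h
  simpa [one_div, ← Finset.Icc_add_one_left_eq_Ioc] using h

theorem sum_card_divisors_le (n : ℕ) :
    ∑ q ∈ Finset.Ioc 0 n, (q.divisors.card : ℝ) ≤ n * (1 + Real.log n) := by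
  have h := ArithmeticFunction.sum_Ioc_sigma0_eq_sum_div n
  have h2 : ∑ q ∈ Finset.Ioc 0 n, (q.divisors.card : ℝ) =
      ∑ d ∈ Finset.Ioc 0 n, ((n / d : ℕ) : ℝ) := by
    have : (∑ q ∈ Finset.Ioc 0 n, q.divisors.card) = ∑ d ∈ Finset.Ioc 0 n, n / d := by
      rw [← h]
      exact Finset.sum_congr rfl fun d _ => (ArithmeticFunction.sigma_zero_apply d).symm
    exact_mod_cast this
  rw [h2]
  calc _ ≤ ∑ d ∈ Finset.Ioc 0 n, (n : ℝ) * (1 / d) := by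
        refine Finset.sum_le_sum fun d _ => ?_
        rw [mul_one_div]
        exact Nat.cast_div_le
    _ = n * ∑ d ∈ Finset.Ioc 0 n, (1 : ℝ) / d := by rw [Finset.mul_sum]
    _ ≤ _ := by gcongr; exact sum_Ioc_inv_le n

/-! ### Mean values of `φ(q) / q` over multiples of `p`. -/

/-- The constant `∑ μ(d) / d²`, i.e. `1 / ζ(2)`. -/
noncomputable def moebiusConst : ℝ := ∑' d : ℕ, (ArithmeticFunction.moebius d : ℝ) / (d : ℝ) ^ 2

theorem abs_moebius_div_sq_le (d : ℕ) :
    |(ArithmeticFunction.moebius d : ℝ) / (d : ℝ) ^ 2| ≤ 1 / (d : ℝ) ^ 2 := by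
  rw [abs_div, abs_of_nonneg (by positivity : (0 : ℝ) ≤ (d : ℝ) ^ 2)]
  gcongr
  exact_mod_cast ArithmeticFunction.abs_moebius_le_one (n := d)

theorem summable_moebius_div_sq :
    Summable fun d : ℕ => (ArithmeticFunction.moebius d : ℝ) / (d : ℝ) ^ 2 :=
  Summable.of_norm_bounded hasSum_zeta_two.summable fun d => abs_moebius_div_sq_le d

/-- Bounding every term but the first below by `-1/n²` gives at least `2 - ζ(2) > 0`. Positivity
makes the number of fractions of exact order `Q²`. -/
theorem moebiusConst_pos : 0 < moebiusConst := by
  have h1 := hasSum_zeta_two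
  have h2 := summable_moebius_div_sq.hasSum
  have h3 : HasSum (fun n : ℕ => if n = 1 then (2 : ℝ) else 0) 2 := hasSum_ite_eq 1 2
  have h4 := hasSum_le (f := fun n : ℕ => (if n = 1 then (2 : ℝ) else 0) - 1 / (n : ℝ) ^ 2)
    (fun n => ?_) (h3.sub h1) h2
  · have hpi := Real.pi_lt_d2
    have hpi0 := Real.pi_pos
    have : (0 : ℝ) < 2 - Real.pi ^ 2 / 6 := by nlinarith
    exact this.trans_le h4
  · by_cases hn : n = 1
    · subst hn; norm_num
    · simp only [hn, if_false, zero_sub]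
      exact neg_le_of_abs_le (abs_moebius_div_sq_le n)

theorem abs_sum_moebius_div_sq_sub_le (n : ℕ) :
    |∑ d ∈ Finset.Ioc 0 n, (ArithmeticFunction.moebius d : ℝ) / (d : ℝ) ^ 2 - moebiusConst| ≤
      2 / ((n : ℝ) + 1) := by
  have ht := (summable_moebius_div_sq.hasSum.tendsto_sum_nat)
  have ht2 := (ht.const_sub
    (∑ d ∈ Finset.Ioc 0 n, (ArithmeticFunction.moebius d : ℝ) / (d : ℝ) ^ 2)).abs
  refine le_of_tendsto ht2 ?_
  filter_upwards [Filter.eventually_ge_atTop (n + 1)] with N hN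
  have hs : ∑ d ∈ Finset.range N, (ArithmeticFunction.moebius d : ℝ) / (d : ℝ) ^ 2 =
      ∑ d ∈ Finset.Ioc 0 n, (ArithmeticFunction.moebius d : ℝ) / (d : ℝ) ^ 2 +
      ∑ d ∈ Finset.Ioo n N, (ArithmeticFunction.moebius d : ℝ) / (d : ℝ) ^ 2 := by
    rw [← Finset.sum_union]
    · symm
      refine Finset.sum_subset ?_ ?_
      · intro x; simp only [Finset.mem_union, Finset.mem_Ioc, Finset.mem_Ioo, Finset.mem_range]
        omega
      · intro x hx hx2
        simp only [Finset.mem_union, Finset.mem_Ioc, Finset.mem_Ioo, Finset.mem_range] at hx hx2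
        have : x = 0 := by omega
        subst this; simp
    · rw [Finset.disjoint_left]
      intro a ha hb
      simp only [Finset.mem_Ioc, Finset.mem_Ioo] at ha hb
      omega
  rw [hs, sub_add_cancel_left, abs_neg]
  refine ((Finset.abs_sum_le_sum_abs _ _).trans (Finset.sum_le_sum fun d _ =>
    abs_moebius_div_sq_le d)).trans ?_
  simpa [one_div] using sum_Ioo_inv_sq_le (α := ℝ) n N

/-- Partial sums of `φ(q) / q` over the multiples `q` of `p`. -/
noncomputable def totientRatioSum (p n : ℕ) : ℝ :=
  ∑ q ∈ (Finset.Ioc 0 n).filter (p ∣ ·), (q.totient : ℝ) / q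

theorem totientRatioSum_one_eq (n : ℕ) :
    totientRatioSum 1 n = ∑ d ∈ Finset.Ioc 0 n,
      (ArithmeticFunction.moebius d : ℝ) / d * ((n / d : ℕ) : ℝ) := by
  let f : ArithmeticFunction ℝ := ⟨fun d => (ArithmeticFunction.moebius d : ℝ) / d, by simp⟩
  have h := ArithmeticFunction.sum_Ioc_mul_zeta_eq_sum f n
  refine Eq.trans ?_ h
  unfold totientRatioSum
  simp only [one_dvd, Finset.filter_true]
  refine Finset.sum_congr rfl fun q hq => ?_
  rw [totient_div_eq_sum_moebius (Finset.mem_Ioc.mp hq).1, ArithmeticFunction.coe_mul_zeta_apply]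
  rfl

/-- Replacing `⌊x/d⌋` by `x/d` costs a harmonic sum, at most `1 + log Q`; completing the Möbius
series costs at most 2. The bound uses `Q` instead of `x` so that it can be reused at `x / p`. -/
theorem abs_totientRatioSum_one_sub_le {Q : ℕ} {x : ℝ} (hx0 : 0 ≤ x) (hxQ : x ≤ Q) :
    |totientRatioSum 1 ⌊x⌋₊ - moebiusConst * x| ≤ 3 + Real.log Q := by
  set n := ⌊x⌋₊ with hn
  have hnx : (n : ℝ) ≤ x := Nat.floor_le hx0
  have hxn : x < n + 1 := Nat.lt_floor_add_one x
  have hnQ : n ≤ Q := by exact_mod_cast hnx.trans hxQ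
  have h1 : |totientRatioSum 1 n -
      x * ∑ d ∈ Finset.Ioc 0 n, (ArithmeticFunction.moebius d : ℝ) / (d : ℝ) ^ 2| ≤
      ∑ d ∈ Finset.Ioc 0 n, (1 : ℝ) / d := by
    rw [totientRatioSum_one_eq, Finset.mul_sum, ← Finset.sum_sub_distrib]
    refine (Finset.abs_sum_le_sum_abs _ _).trans (Finset.sum_le_sum fun d hd => ?_)
    have hd0 : (0 : ℝ) < d := by exact_mod_cast (Finset.mem_Ioc.mp hd).1
    have hfl : n / d = ⌊x / d⌋₊ := by rw [hn, Nat.floor_div_natCast]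
    have e : (ArithmeticFunction.moebius d : ℝ) / d * ((n / d : ℕ) : ℝ) -
        x * ((ArithmeticFunction.moebius d : ℝ) / (d : ℝ) ^ 2) =
        ((ArithmeticFunction.moebius d : ℝ) / d) * (((n / d : ℕ) : ℝ) - x / d) := by
      field_simp
    rw [e, abs_mul, abs_div, abs_of_pos hd0]
    have h2 : |(ArithmeticFunction.moebius d : ℝ)| ≤ 1 := by
      exact_mod_cast ArithmeticFunction.abs_moebius_le_one (n := d)
    have h3 : |((n / d : ℕ) : ℝ) - x / d| ≤ 1 := by
      rw [hfl, abs_le]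
      have a1 := Nat.floor_le (div_nonneg hx0 hd0.le)
      have a2 := Nat.lt_floor_add_one (x / d)
      constructor <;> linarith
    calc _ ≤ 1 / (d : ℝ) * 1 := by gcongr
      _ = _ := mul_one _
  have h2 := sum_Ioc_inv_le n
  have h3 : Real.log n ≤ Real.log Q := by
    rcases Nat.eq_zero_or_pos n with h | h
    · rw [h]; simpa using Real.log_natCast_nonneg Q
    · exact Real.log_le_log (by exact_mod_cast h) (by exact_mod_cast hnQ)
  have h4 : |x * ∑ d ∈ Finset.Ioc 0 n, (ArithmeticFunction.moebius d : ℝ) / (d : ℝ) ^ 2 -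
      moebiusConst * x| ≤ 2 := by
    rw [mul_comm moebiusConst, ← mul_sub, abs_mul, abs_of_nonneg hx0]
    have hpos : (0 : ℝ) < (n : ℝ) + 1 := by positivity
    calc _ ≤ ((n : ℝ) + 1) * (2 / ((n : ℝ) + 1)) :=
          mul_le_mul hxn.le (abs_sum_moebius_div_sq_sub_le n) (abs_nonneg _) hpos.le
      _ = 2 := by field_simp
  have h5 := abs_sub_le (totientRatioSum 1 n)
    (x * ∑ d ∈ Finset.Ioc 0 n, (ArithmeticFunction.moebius d : ℝ) / (d : ℝ) ^ 2) (moebiusConst * x)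
  linarith

/-- Write `q = p m`: `φ(q)/q` is `φ(m)/m` if `p ∣ m`, and `(1 - 1/p) φ(m)/m` otherwise. -/
theorem totientRatioSum_prime {p : ℕ} (hp : p.Prime) (n : ℕ) :
    totientRatioSum p n = (1 - 1 / (p : ℝ)) * totientRatioSum 1 (n / p) +
      1 / (p : ℝ) * totientRatioSum p (n / p) := by
  have hp0 : (p : ℝ) ≠ 0 := by exact_mod_cast hp.ne_zero
  have h1 : totientRatioSum p n =
      ∑ m ∈ Finset.Ioc 0 (n / p), ((p * m).totient : ℝ) / ((p * m : ℕ) : ℝ) := by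
    unfold totientRatioSum
    symm
    refine Finset.sum_bij (fun m _ => p * m) ?_ ?_ ?_ fun _ _ => rfl
    · intro m hm
      simp only [Finset.mem_Ioc, Finset.mem_filter] at hm ⊢
      refine ⟨⟨Nat.mul_pos hp.pos hm.1, ?_⟩, dvd_mul_right _ _⟩
      rw [mul_comm]; exact (Nat.le_div_iff_mul_le hp.pos).mp hm.2
    · intro a _ b _ hab
      exact Nat.eq_of_mul_eq_mul_left hp.pos hab
    · intro q hq
      simp only [Finset.mem_Ioc, Finset.mem_filter] at hq
      obtain ⟨m, rfl⟩ := hq.2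
      refine ⟨m, ?_, rfl⟩
      simp only [Finset.mem_Ioc]
      refine ⟨Nat.pos_of_mul_pos_left hq.1.1, ?_⟩
      rw [Nat.le_div_iff_mul_le hp.pos, mul_comm]; exact hq.1.2
  rw [h1]
  unfold totientRatioSum
  simp only [one_dvd, Finset.filter_true]
  rw [Finset.sum_filter, Finset.mul_sum, Finset.mul_sum, ← Finset.sum_add_distrib]
  refine Finset.sum_congr rfl fun m hm => ?_
  have hm0 : (m : ℝ) ≠ 0 := by
    have := (Finset.mem_Ioc.mp hm).1
    exact_mod_cast this.ne'
  by_cases h : p ∣ m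
  · rw [if_pos h, Nat.totient_mul_of_prime_of_dvd hp h]
    push_cast; field_simp; ring
  · rw [if_neg h, Nat.totient_mul_of_prime_of_not_dvd hp h]
    push_cast [Nat.cast_sub hp.one_le]; field_simp; ring

/-- The recursion from `x` to `x / p` is a convex combination, so the error never grows and the
bound is independent of `p`. The constant `γ = c / (p + 1)` is the solution of `γ = (1 - 1/p) c/p +
γ/p²`. -/
theorem abs_totientRatioSum_prime_sub_le {p : ℕ} (hp : p.Prime) {Q : ℕ} {x : ℝ} (hx0 : 0 ≤ x)
    (hxQ : x ≤ Q) :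
    |totientRatioSum p ⌊x⌋₊ - moebiusConst / (p + 1) * x| ≤ 3 + Real.log Q := by
  have hp2 : (2 : ℝ) ≤ p := by exact_mod_cast hp.two_le
  induction hn : ⌊x⌋₊ using Nat.strong_induction_on generalizing x with
  | _ n ih =>
    have hc := moebiusConst_pos
    rcases Nat.eq_zero_or_pos n with h0 | h0
    · subst h0
      have h1 := abs_totientRatioSum_one_sub_le hx0 hxQ
      rw [hn] at h1
      simp only [totientRatioSum, Finset.Ioc_self, Finset.filter_empty, Finset.sum_empty, zero_sub,
        abs_neg] at h1 ⊢
      refine le_trans ?_ h1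
      rw [abs_of_nonneg (by positivity), abs_of_nonneg (by positivity)]
      gcongr
      exact div_le_self hc.le (by linarith)
    · have hfl : ⌊x / p⌋₊ = n / p := by rw [← hn, Nat.floor_div_natCast]
      have hxp0 : 0 ≤ x / p := by positivity
      have hxpQ : x / p ≤ Q := (div_le_self hx0 (by linarith)).trans hxQ
      have h1 := abs_totientRatioSum_one_sub_le hxp0 hxpQ
      have h2 := ih (n / p) (Nat.div_lt_self h0 hp.one_lt) hxp0 hxpQ hfl
      rw [hfl] at h1
      rw [totientRatioSum_prime hp]
      have e : (1 - 1 / (p : ℝ)) * totientRatioSum 1 (n / p) +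
          1 / (p : ℝ) * totientRatioSum p (n / p) - moebiusConst / (p + 1) * x =
          (1 - 1 / (p : ℝ)) * (totientRatioSum 1 (n / p) - moebiusConst * (x / p)) +
          1 / (p : ℝ) * (totientRatioSum p (n / p) - moebiusConst / (p + 1) * (x / p)) := by
        field_simp; ring
      rw [e]
      have hq1 : 0 ≤ 1 - 1 / (p : ℝ) := by
        rw [sub_nonneg, div_le_one (by linarith)]; linarith
      have hq2 : 0 ≤ 1 / (p : ℝ) := by positivity
      rw [abs_le] at h1 h2 ⊢
      constructor <;> nlinarith

/-! ### Partial summation. -/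

/-- Partial sums of `φ(q)` over the multiples `q` of `p`. -/
noncomputable def totientSum (p n : ℕ) : ℝ :=
  ∑ q ∈ (Finset.Ioc 0 n).filter (p ∣ ·), (q.totient : ℝ)

theorem totientSum_eq (p n : ℕ) :
    totientSum p n = n * totientRatioSum p n - ∑ m ∈ Finset.range n, totientRatioSum p m := by
  induction n with
  | zero => simp [totientSum]
  | succ n ih =>
    have h1 : totientSum p (n + 1) = totientSum p n +
        (n + 1) * (totientRatioSum p (n + 1) - totientRatioSum p n) := by
      unfold totientSum totientRatioSum
      rw [Finset.sum_filter, Finset.sum_filter, Finset.sum_filter, Finset.sum_filter,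
        Finset.sum_Ioc_succ_top (Nat.zero_le n), Finset.sum_Ioc_succ_top (Nat.zero_le n),
        add_sub_cancel_left]
      congr 1
      split_ifs
      · push_cast; field_simp
      · simp
    rw [h1, ih, Finset.sum_range_succ]
    push_cast; ring

/-- Partial summation: from the partial sums of `φ(q)/q` to those of `φ(q)`. -/
theorem abs_totientSum_sub_le {p Q : ℕ} {γ E : ℝ} (hγ0 : 0 ≤ γ)
    (hE : ∀ x : ℝ, 0 ≤ x → x ≤ Q → |totientRatioSum p ⌊x⌋₊ - γ * x| ≤ E)
    {x : ℝ} (hx0 : 0 ≤ x) (hxQ : x ≤ Q) :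
    |totientSum p ⌊x⌋₊ - γ * x ^ 2 / 2| ≤ x * (2 * E + γ) := by
  set n := ⌊x⌋₊ with hn
  have hnx : (n : ℝ) ≤ x := Nat.floor_le hx0
  have hxn : x < n + 1 := Nat.lt_floor_add_one x
  have hnQ : n ≤ Q := by exact_mod_cast hnx.trans hxQ
  have hn0 : (0 : ℝ) ≤ n := Nat.cast_nonneg n
  have h1 : |∑ m ∈ Finset.range n, totientRatioSum p m - γ * (n : ℝ) ^ 2 / 2| ≤ n * E := by
    -- Sampling the main term at the midpoints `m + 1/2`, whose floor is `m`, makes its sum exactly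
    -- `γ n² / 2`.
    have e : γ * (n : ℝ) ^ 2 / 2 = ∑ m ∈ Finset.range n, γ * ((m : ℝ) + 1 / 2) := by
      clear_value n
      clear hnQ hxn hnx hn hn0
      induction n with
      | zero => simp
      | succ n ih => rw [Finset.sum_range_succ, ← ih]; push_cast; ring
    rw [e, ← Finset.sum_sub_distrib]
    refine (Finset.abs_sum_le_sum_abs _ _).trans ?_
    have : ∀ m ∈ Finset.range n, |totientRatioSum p m - γ * ((m : ℝ) + 1 / 2)| ≤ E := by
      intro m hm
      have hm' : m + 1 ≤ n := Finset.mem_range.mp hm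
      have hm2 : (m : ℝ) + 1 ≤ n := by exact_mod_cast hm'
      have hfl : ⌊(m : ℝ) + 1 / 2⌋₊ = m := by
        rw [Nat.floor_eq_iff (by positivity)]; constructor <;> linarith
      have := hE ((m : ℝ) + 1 / 2) (by positivity) (by linarith)
      rwa [hfl] at this
    refine (Finset.sum_le_sum this).trans ?_
    simp
  have h2 := hE n hn0 (by exact_mod_cast hnQ)
  rw [Nat.floor_natCast] at h2
  have hE0 : 0 ≤ E := (abs_nonneg _).trans h2
  rw [totientSum_eq]
  rw [abs_le] at h1 h2 ⊢
  have a1 : (n : ℝ) * E ≤ x * E := by gcongr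
  have a2 : γ * (x ^ 2 - (n : ℝ) ^ 2) / 2 ≤ x * γ := by
    have : x ^ 2 - (n : ℝ) ^ 2 ≤ 2 * x := by nlinarith
    nlinarith
  have a3 : 0 ≤ γ * (x ^ 2 - (n : ℝ) ^ 2) / 2 := by
    have : 0 ≤ x ^ 2 - (n : ℝ) ^ 2 := by nlinarith
    positivity
  have a4 := mul_le_mul_of_nonneg_left h2.1 hn0
  have a5 := mul_le_mul_of_nonneg_left h2.2 hn0
  have a6 : 0 ≤ x * γ := by positivity
  constructor <;> nlinarith

/-! ### Counting the lattice pairs. -/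

/-- The pairs `(q, m)` of coprime integers in `[1, Q]` with `q + m > Q`, `p ∣ q` and
`⌊(Q + m) / q⌋ ≥ j`. -/
def latticePairs (Q p j : ℕ) : Finset (ℕ × ℕ) :=
  (Finset.Ioc 0 Q ×ˢ Finset.Ioc 0 Q).filter fun r =>
    p ∣ r.1 ∧ Nat.Coprime r.1 r.2 ∧ Q < r.1 + r.2 ∧ j * r.1 ≤ Q + r.2

theorem card_latticePairs (Q p j : ℕ) :
    (latticePairs Q p j).card = ∑ q ∈ (Finset.Ioc 0 Q).filter (p ∣ ·),
      ((Finset.Ioc (max (Q - q) (j * q - Q - 1)) Q).filter (fun m => Nat.Coprime q m)).card := by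
  rw [latticePairs, Finset.card_filter, Finset.sum_product, Finset.sum_filter]
  refine Finset.sum_congr rfl fun q hq => ?_
  simp only [Finset.mem_Ioc] at hq
  split_ifs with h
  · rw [← Finset.card_filter]
    congr 1
    ext m
    simp only [Finset.mem_filter, Finset.mem_Ioc, h, true_and]
    generalize j * q = t
    constructor
    · rintro ⟨h1, h2, h3, h4⟩
      exact ⟨by omega, h2⟩
    · rintro ⟨h1, h2⟩
      exact ⟨by omega, h2, by omega, by omega⟩
  · simp [h]

/-- The length of the window for `m` in `latticePairs`. -/
noncomputable def windowLength (Q j q : ℕ) : ℝ :=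
  max 0 (min (q : ℝ) (2 * (Q : ℝ) - j * q))

/-- One `d(q)` comes from the coprimality sieve. The other absorbs an error of at most 1 in the
length, due to the `- 1` that turns `j q ≤ Q + m` into a strict lower bound for `m`. -/
theorem abs_card_window_sub_le {Q q : ℕ} (j : ℕ) (hq : 0 < q) (hqQ : q ≤ Q) :
    |(((Finset.Ioc (max (Q - q) (j * q - Q - 1)) Q).filter
      (fun m => Nat.Coprime q m)).card : ℝ) - (q.totient : ℝ) / q * windowLength Q j q| ≤
      2 * q.divisors.card := by
  have hw0 : 0 ≤ (q.totient : ℝ) / q := by positivity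
  have hw1 : (q.totient : ℝ) / q ≤ 1 := by
    rw [div_le_one (by exact_mod_cast hq)]; exact_mod_cast Nat.totient_le q
  have hd : (1 : ℝ) ≤ q.divisors.card := by
    exact_mod_cast Finset.card_pos.mpr ⟨1, Nat.one_mem_divisors.mpr hq.ne'⟩
  have hqQ' : (q : ℝ) ≤ Q := by exact_mod_cast hqQ
  have hq' : (0 : ℝ) < q := by exact_mod_cast hq
  rcases le_or_gt (max (Q - q) (j * q - Q - 1)) Q with hA | hA
  · have h1 := abs_card_filter_coprime_Ioc_sub_le hq hA
    set A := max (Q - q) (j * q - Q - 1) with hAdef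
    have h2 : |((Q : ℝ) - A) - windowLength Q j q| ≤ 1 := by
      have hcast : (j : ℝ) * q = ((j * q : ℕ) : ℝ) := by push_cast; rfl
      rw [windowLength, hcast]
      clear_value A
      generalize j * q = t at *
      have c1 : (A : ℝ) + q ≥ Q := by
        have : A + q ≥ Q := by omega
        exact_mod_cast this
      have c2 : (A : ℝ) + Q + 1 ≥ t := by
        have : A + Q + 1 ≥ t := by omega
        exact_mod_cast this
      have c4 : (A : ℝ) ≤ Q := by exact_mod_cast hA
      have c3 : (A : ℝ) + q = Q ∨ (A : ℝ) + Q + 1 = t := by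
        have : A + q = Q ∨ A + Q + 1 = t := by omega
        exact_mod_cast this
      rw [abs_le]
      constructor
      · have : max 0 (min (q : ℝ) (2 * (Q : ℝ) - t)) ≤ (Q : ℝ) - A + 1 := by
          refine max_le (by linarith) ?_
          rcases c3 with c | c
          · exact (min_le_left _ _).trans (by linarith)
          · exact (min_le_right _ _).trans (by linarith)
        linarith
      · have : (Q : ℝ) - A - 1 ≤ max 0 (min (q : ℝ) (2 * (Q : ℝ) - t)) :=
          le_max_of_le_right (le_min (by linarith) (by linarith))
        linarith
    have e : ∀ N w L l : ℝ, N - w * l = (N - w * L) + w * (L - l) := fun _ _ _ _ => by ring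
    rw [e _ _ ((Q : ℝ) - A)]
    refine (abs_add_le _ _).trans ?_
    rw [abs_mul, abs_of_nonneg hw0]
    have := mul_le_one₀ hw1 (abs_nonneg _) h2
    linarith
  · have h0 : windowLength Q j q = 0 := by
      have hcast : (j : ℝ) * q = ((j * q : ℕ) : ℝ) := by push_cast; rfl
      rw [windowLength, hcast]
      generalize j * q = t at *
      have : 2 * Q ≤ t := by omega
      have : 2 * (Q : ℝ) ≤ t := by exact_mod_cast this
      exact max_eq_left ((min_le_right _ _).trans (by linarith))
    rw [Finset.Ioc_eq_empty (by omega), h0]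
    simp

theorem sum_Ioc_filter_ite_le (p : ℕ) {a Q : ℕ} (haQ : a ≤ Q) (f : ℕ → ℝ) :
    ∑ q ∈ (Finset.Ioc 0 Q).filter (p ∣ ·), (if q ≤ a then f q else 0) =
      ∑ q ∈ (Finset.Ioc 0 a).filter (p ∣ ·), f q := by
  rw [← Finset.sum_filter]
  refine Finset.sum_congr ?_ fun _ _ => rfl
  ext q
  simp only [Finset.mem_filter, Finset.mem_Ioc]
  constructor
  · rintro ⟨⟨⟨h1, h2⟩, h3⟩, h4⟩; exact ⟨⟨h1, h4⟩, h3⟩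
  · rintro ⟨⟨h1, h2⟩, h3⟩; exact ⟨⟨⟨h1, by omega⟩, h3⟩, h2⟩

theorem sum_ratio_mul_linear (p n : ℕ) (u v : ℝ) :
    ∑ q ∈ (Finset.Ioc 0 n).filter (p ∣ ·), (q.totient : ℝ) / q * (u * q + v) =
      u * totientSum p n + v * totientRatioSum p n := by
  unfold totientSum totientRatioSum
  rw [Finset.mul_sum, Finset.mul_sum, ← Finset.sum_add_distrib]
  refine Finset.sum_congr rfl fun q hq => ?_
  have : (q : ℝ) ≠ 0 := by
    have := (Finset.mem_Ioc.mp (Finset.mem_filter.mp hq).1).1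
    exact_mod_cast this.ne'
  field_simp

/-- The length is `q` up to `2Q/(j+1)`, then `2Q - j q` up to `2Q/j`, then 0. Since `q = ((j+1) q -
2Q) + (2Q - j q)`, it is a sum of two truncated linear functions. The condition `2 ≤ j` keeps both
cutoffs within `Q`. -/
theorem sum_ratio_mul_windowLength {Q j : ℕ} (p : ℕ) (hj : 2 ≤ j) :
    ∑ q ∈ (Finset.Ioc 0 Q).filter (p ∣ ·), (q.totient : ℝ) / q * windowLength Q j q =
      ((j + 1) * totientSum p ⌊2 * (Q : ℝ) / (j + 1)⌋₊ -
        2 * Q * totientRatioSum p ⌊2 * (Q : ℝ) / (j + 1)⌋₊) +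
      (2 * Q * totientRatioSum p ⌊2 * (Q : ℝ) / j⌋₊ - j * totientSum p ⌊2 * (Q : ℝ) / j⌋₊) := by
  have hj' : (2 : ℝ) ≤ j := by exact_mod_cast hj
  have hQ0 : (0 : ℝ) ≤ Q := Nat.cast_nonneg Q
  have hb : ⌊2 * (Q : ℝ) / j⌋₊ ≤ Q := by
    refine Nat.floor_le_of_le ?_
    rw [div_le_iff₀ (by linarith)]; nlinarith
  have ha : ⌊2 * (Q : ℝ) / (j + 1)⌋₊ ≤ Q := by
    refine Nat.floor_le_of_le ?_
    rw [div_le_iff₀ (by linarith)]; nlinarith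
  have l1 := sum_ratio_mul_linear p ⌊2 * (Q : ℝ) / (j + 1)⌋₊ (j + 1) (-(2 * Q))
  have l2 := sum_ratio_mul_linear p ⌊2 * (Q : ℝ) / j⌋₊ (-j) (2 * Q)
  rw [← sum_Ioc_filter_ite_le p ha] at l1
  rw [← sum_Ioc_filter_ite_le p hb] at l2
  have : ∑ q ∈ (Finset.Ioc 0 Q).filter (p ∣ ·), (q.totient : ℝ) / q * windowLength Q j q =
      (((j : ℝ) + 1) * totientSum p ⌊2 * (Q : ℝ) / (j + 1)⌋₊ +
        -(2 * Q) * totientRatioSum p ⌊2 * (Q : ℝ) / (j + 1)⌋₊) +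
      (-j * totientSum p ⌊2 * (Q : ℝ) / j⌋₊ + 2 * Q * totientRatioSum p ⌊2 * (Q : ℝ) / j⌋₊) := by
    rw [← l1, ← l2, ← Finset.sum_add_distrib]
    refine Finset.sum_congr rfl fun q hq => ?_
    have hq0 : (0 : ℝ) < q := by
      have := (Finset.mem_Ioc.mp (Finset.mem_filter.mp hq).1).1
      exact_mod_cast this
    have i1 : q ≤ ⌊2 * (Q : ℝ) / (j + 1)⌋₊ ↔ ((j : ℝ) + 1) * q ≤ 2 * Q := by
      rw [Nat.le_floor_iff (by positivity), le_div_iff₀ (by positivity), mul_comm]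
    have i2 : q ≤ ⌊2 * (Q : ℝ) / j⌋₊ ↔ (j : ℝ) * q ≤ 2 * Q := by
      rw [Nat.le_floor_iff (by positivity), le_div_iff₀ (by positivity), mul_comm]
    simp only [i1, i2]
    unfold windowLength
    split_ifs with c1 c2 c2
    · rw [min_eq_left (by linarith), max_eq_right hq0.le]; ring
    · exfalso; linarith
    · rw [min_eq_right (by linarith), max_eq_right (by linarith)]; ring
    · rw [min_eq_right (by linarith), max_eq_left (by linarith)]; ring
  rw [this]; ring

/-- At the cutoff `2Q/t` the main terms are `2γQ²/t` and `4γQ²/t`, leaving `-2γQ²/t`; the values at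
`t = j` and `t = j + 1` then combine to `2γQ²/(j(j+1))`. -/
theorem abs_mul_totientSum_sub_le {p Q : ℕ} {γ E t : ℝ} (hγ0 : 0 ≤ γ)
    (hE : ∀ x : ℝ, 0 ≤ x → x ≤ Q → |totientRatioSum p ⌊x⌋₊ - γ * x| ≤ E) (ht : 2 ≤ t) :
    |(t * totientSum p ⌊2 * (Q : ℝ) / t⌋₊ - 2 * Q * totientRatioSum p ⌊2 * (Q : ℝ) / t⌋₊) +
      2 * γ * Q ^ 2 / t| ≤ 2 * Q * (3 * E + γ) := by
  have hQ0 : (0 : ℝ) ≤ Q := Nat.cast_nonneg Q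
  have hx0 : 0 ≤ 2 * (Q : ℝ) / t := by positivity
  have hxQ : 2 * (Q : ℝ) / t ≤ Q := by rw [div_le_iff₀ (by linarith)]; nlinarith
  have h1 := abs_totientSum_sub_le hγ0 hE hx0 hxQ
  have h2 := hE _ hx0 hxQ
  have e : (t * totientSum p ⌊2 * (Q : ℝ) / t⌋₊ - 2 * Q * totientRatioSum p ⌊2 * (Q : ℝ) / t⌋₊) +
      2 * γ * Q ^ 2 / t = t * (totientSum p ⌊2 * (Q : ℝ) / t⌋₊ - γ * (2 * (Q : ℝ) / t) ^ 2 / 2) -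
      2 * Q * (totientRatioSum p ⌊2 * (Q : ℝ) / t⌋₊ - γ * (2 * (Q : ℝ) / t)) := by
    field_simp; ring
  rw [e]
  refine (abs_sub _ _).trans ?_
  rw [abs_mul, abs_mul, abs_of_nonneg (by linarith : 0 ≤ t), abs_of_nonneg (by linarith : 0 ≤ 2 * (Q : ℝ))]
  calc _ ≤ t * (2 * (Q : ℝ) / t * (2 * E + γ)) + 2 * Q * E := by gcongr
    _ = _ := by field_simp; ring

theorem abs_card_latticePairs_sub_le {p Q j : ℕ} {γ E : ℝ} (hj : 2 ≤ j) (hγ0 : 0 ≤ γ)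
    (hE : ∀ x : ℝ, 0 ≤ x → x ≤ Q → |totientRatioSum p ⌊x⌋₊ - γ * x| ≤ E) :
    |((latticePairs Q p j).card : ℝ) - 2 * γ * Q ^ 2 / (j * (j + 1))| ≤
      2 * (Q * (1 + Real.log Q)) + 4 * Q * (3 * E + γ) := by
  have hj' : (2 : ℝ) ≤ j := by exact_mod_cast hj
  have h1 : |((latticePairs Q p j).card : ℝ) -
      ∑ q ∈ (Finset.Ioc 0 Q).filter (p ∣ ·), (q.totient : ℝ) / q * windowLength Q j q| ≤
      2 * (Q * (1 + Real.log Q)) := by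
    rw [card_latticePairs]
    push_cast
    rw [← Finset.sum_sub_distrib]
    calc _ ≤ ∑ q ∈ (Finset.Ioc 0 Q).filter (p ∣ ·), 2 * (q.divisors.card : ℝ) := by
          refine (Finset.abs_sum_le_sum_abs _ _).trans (Finset.sum_le_sum fun q hq => ?_)
          have hq' := Finset.mem_Ioc.mp (Finset.mem_filter.mp hq).1
          exact abs_card_window_sub_le j hq'.1 hq'.2
      _ ≤ ∑ q ∈ Finset.Ioc 0 Q, 2 * (q.divisors.card : ℝ) :=
          Finset.sum_le_sum_of_subset_of_nonneg (Finset.filter_subset _ _)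
            fun _ _ _ => by positivity
      _ ≤ _ := by
          rw [← Finset.mul_sum]
          have := sum_card_divisors_le Q
          linarith
  rw [sum_ratio_mul_windowLength p hj] at h1
  have h2 := abs_mul_totientSum_sub_le hγ0 hE hj'
  have h3 := abs_mul_totientSum_sub_le hγ0 hE (by linarith : (2 : ℝ) ≤ j + 1)
  have e : 2 * γ * (Q : ℝ) ^ 2 / (j * (j + 1)) = 2 * γ * Q ^ 2 / j - 2 * γ * Q ^ 2 / (j + 1) := by
    field_simp; ring
  rw [e]
  rw [abs_le] at h1 h2 h3 ⊢
  constructor <;> linarith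

/-! ### Determinants and Farey neighbours. -/

theorem fareyDet_pos_iff {x y : ℚ} : 0 < fareyDet x y ↔ x < y := by
  rw [fareyDet, sub_pos, Rat.lt_iff, mul_comm y.num]

theorem den_mul_fareyDet (x y z : ℚ) :
    (z.den : ℤ) * fareyDet x y = x.den * fareyDet z y + y.den * fareyDet x z := by
  unfold fareyDet; ring

theorem den_add_den_le_of_between {x y z : ℚ} (h : fareyDet x y = 1) (hxz : x < z) (hzy : z < y) :
    x.den + y.den ≤ z.den := by
  have e := den_mul_fareyDet x y z
  have h1 : 1 ≤ fareyDet z y := fareyDet_pos_iff.mpr hzy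
  have h2 : 1 ≤ fareyDet x z := fareyDet_pos_iff.mpr hxz
  have hx : (0 : ℤ) ≤ x.den := by positivity
  have hy : (0 : ℤ) ≤ y.den := by positivity
  rw [h, mul_one] at e
  have : (x.den : ℤ) + y.den ≤ z.den := by nlinarith
  exact_mod_cast this

/-- Bézout, with one of the coefficients in a prescribed window. -/
theorem exists_mul_sub_mul_eq_one {q m : ℤ} (hq : 0 < q) (h : IsCoprime m q) (c : ℤ) :
    ∃ u v : ℤ, m * u - q * v = 1 ∧ c < u ∧ u ≤ c + q := by
  obtain ⟨s, t, hst⟩ := h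
  have h1 := Int.emod_nonneg (s - c - 1) hq.ne'
  have h2 := Int.emod_lt_of_pos (s - c - 1) hq
  have h3 := Int.emod_add_mul_ediv (s - c - 1) q
  refine ⟨c + 1 + (s - c - 1) % q, -t - m * ((s - c - 1) / q), ?_, by omega, by omega⟩
  have e : (s - c - 1) % q = (s - c - 1) - q * ((s - c - 1) / q) := by linarith
  rw [e]
  linear_combination hst

theorem exists_rat_num_den {a : ℤ} {q : ℤ} (hq : 0 < q) (h : IsCoprime a q) :
    ∃ x : ℚ, x.num = a ∧ (x.den : ℤ) = q := by
  obtain ⟨n, rfl⟩ := Int.eq_ofNat_of_zero_le hq.le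
  refine ⟨⟨a, n, by rintro rfl; simp at hq, ?_⟩, rfl, rfl⟩
  exact Int.isCoprime_iff_gcd_eq_one.mp h

theorem ratNum_le_den_iff {x : ℚ} : x.num ≤ x.den ↔ x ≤ 1 := by
  rw [Rat.le_iff]; simp

theorem ratNum_lt_den_iff {x : ℚ} : x.num < x.den ↔ x < 1 := by
  rw [Rat.lt_iff]; simp

/-- The successor of `z` in the Farey sequence. -/
theorem exists_farey_succ {Q : ℕ} {z : ℚ} (hz : z ∈ farey Q) (hz1 : z < 1) :
    ∃ y ∈ farey Q, fareyDet z y = 1 ∧ Q < z.den + y.den := by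
  obtain ⟨h0, -, hQ⟩ := hz
  have hq : (0 : ℤ) < z.den := by exact_mod_cast z.den_pos
  -- The successor is `-b / r`; the window `(Q - z.den, Q]` for `r` makes it admissible and forces
  -- the denominators to sum to more than `Q`.
  obtain ⟨r, b, hrb, h1, h2⟩ := exists_mul_sub_mul_eq_one hq (Rat.isCoprime_num_den z).neg_left
    ((Q : ℤ) - z.den)
  have hQ' : (z.den : ℤ) ≤ Q := by exact_mod_cast hQ
  have hr : 0 < r := by omega
  obtain ⟨y, hyb, hyr⟩ := exists_rat_num_den (a := -b) hr ⟨z.den, -z.num, by linarith⟩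
  have ha0 : 0 ≤ z.num := Rat.num_nonneg.mpr h0
  have ha1 : z.num < z.den := ratNum_lt_den_iff.mpr hz1
  have hdet : fareyDet z y = 1 := by
    rw [fareyDet, hyb, hyr]; linarith
  have hlt : z < y := fareyDet_pos_iff.mp (by rw [hdet]; norm_num)
  refine ⟨y, ⟨h0.trans hlt.le, ?_, ?_⟩, hdet, ?_⟩
  · rw [← ratNum_le_den_iff, hyb, hyr]
    have : (z.den : ℤ) * (-b) ≤ z.den * r := by nlinarith
    exact le_of_mul_le_mul_left this hq
  · have : (y.den : ℤ) ≤ Q := by omega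
    exact_mod_cast this
  · have : (Q : ℤ) < z.den + y.den := by omega
    exact_mod_cast this

/-- Consecutive elements of `fareyPrimeTo Q p` with determinant at least two enclose exactly one
further Farey fraction. -/
theorem exists_between_of_areConsecutive {Q p : ℕ} (hp : p.Prime) {x y : ℚ}
    (h : AreConsecutive (fareyPrimeTo Q p) x y) (hdet : 2 ≤ fareyDet x y) :
    ∃ z ∈ farey Q, fareyDet x z = 1 ∧ fareyDet z y = 1 ∧ p ∣ z.den ∧ Q < x.den + z.den ∧
      Q < z.den + y.den := by
  obtain ⟨hx, hy, hxy, hcons⟩ := h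
  obtain ⟨z, hz, hxz, hQ1⟩ := exists_farey_succ hx.1 (hxy.trans_le hy.1.2.1)
  have hxz' : x < z := fareyDet_pos_iff.mp (by rw [hxz]; norm_num)
  have hnot : ¬ y < z := fun hyz => by
    have := den_add_den_le_of_between hxz hxy hyz
    have := hy.1.2.2
    omega
  have hyz : y ≠ z := by
    rintro rfl; omega
  have hzy : z < y := lt_of_le_of_ne (not_lt.mp hnot) hyz.symm
  have hpz : p ∣ z.den := by
    by_contra hpz
    exact hcons z ⟨hz, hpz⟩ ⟨hxz', hzy⟩
  obtain ⟨y', hy', hzy', hQ2⟩ := exists_farey_succ hz (hzy.trans_le hy.1.2.1)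
  have hlt : z < y' := fareyDet_pos_iff.mp (by rw [hzy']; norm_num)
  have hpy' : ¬ p ∣ y'.den := fun hd => by
    have hd1 : (p : ℤ) ∣ fareyDet z y' :=
      dvd_sub ((Int.natCast_dvd_natCast.mpr hpz).mul_right _)
        ((Int.natCast_dvd_natCast.mpr hd).mul_left _)
    rw [hzy'] at hd1
    exact hp.one_lt.ne' (Nat.dvd_one.mp (by exact_mod_cast hd1))
  have hyy : y = y' := by
    rcases lt_trichotomy y y' with hl | he | hl
    · have := den_add_den_le_of_between hzy' hzy hl
      have := hy.1.2.2
      omega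
    · exact he
    · exact absurd ⟨hxz'.trans hlt, hl⟩ (hcons y' ⟨hy', hpy'⟩)
  subst hyy
  exact ⟨z, hz, hxz, hzy', hpz, hQ1, hQ2⟩

theorem areConsecutive_of_between {Q p : ℕ} (hp : p.Prime) {x y z : ℚ} (hx : x ∈ farey Q)
    (hy : y ∈ farey Q) (hxz : fareyDet x z = 1) (hzy : fareyDet z y = 1) (hpz : p ∣ z.den)
    (hQ1 : Q < x.den + z.den) (hQ2 : Q < z.den + y.den) :
    AreConsecutive (fareyPrimeTo Q p) x y := by
  have hxz' : x < z := fareyDet_pos_iff.mp (by rw [hxz]; norm_num)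
  have hzy' : z < y := fareyDet_pos_iff.mp (by rw [hzy]; norm_num)
  have hpz' := Int.natCast_dvd_natCast.mpr hpz
  have hp1 : ¬ (p : ℤ) ∣ 1 := fun h => hp.one_lt.ne' (Nat.dvd_one.mp (by exact_mod_cast h))
  refine ⟨⟨hx, fun hd => hp1 ?_⟩, ⟨hy, fun hd => hp1 ?_⟩, hxz'.trans hzy', ?_⟩
  · rw [← hxz]
    exact dvd_sub ((Int.natCast_dvd_natCast.mpr hd).mul_right _) (hpz'.mul_left _)
  · rw [← hzy]
    exact dvd_sub (hpz'.mul_right _) ((Int.natCast_dvd_natCast.mpr hd).mul_left _)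
  · rintro w ⟨hw, hpw⟩ ⟨h1, h2⟩
    have hwQ := hw.2.2
    rcases lt_trichotomy w z with hl | rfl | hl
    · have := den_add_den_le_of_between hxz h1 hl
      omega
    · exact hpw hpz
    · have := den_add_den_le_of_between hzy hl h2
      omega

/-! ### Bijection between pairs and lattice points. -/

/-- The pairs of consecutive elements of `fareyPrimeTo Q p` with determinant at least `j`. -/
def fareyPairsGE (Q p j : ℕ) : Set (ℚ × ℚ) :=
  {r | AreConsecutive (fareyPrimeTo Q p) r.1 r.2 ∧ (j : ℤ) ≤ fareyDet r.1 r.2}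

theorem AreConsecutive.right_unique {S : Set ℚ} {x y y' : ℚ} (h : AreConsecutive S x y)
    (h' : AreConsecutive S x y') : y = y' := by
  rcases lt_trichotomy y y' with hl | he | hl
  · exact absurd ⟨h.2.2.1, hl⟩ (h'.2.2.2 y h.2.1)
  · exact he
  · exact absurd ⟨h'.2.2.1, hl⟩ (h.2.2.2 y' h'.2.1)

/-- This recovers the deleted denominator from the pair alone, so the bijection needs no choice of
`z`. -/
theorem den_add_den_div_fareyDet {x y z : ℚ} (hxz : fareyDet x z = 1) (hzy : fareyDet z y = 1) :
    (((x.den : ℤ) + y.den) / fareyDet x y).toNat = z.den := by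
  have e := den_mul_fareyDet x y z
  rw [hxz, hzy, mul_one, mul_one] at e
  have hlt : x < y := (fareyDet_pos_iff.mp (by rw [hxz]; norm_num)).trans
    (fareyDet_pos_iff.mp (by rw [hzy]; norm_num))
  rw [← e, Int.mul_ediv_cancel _ (fareyDet_pos_iff.mpr hlt).ne', Int.toNat_natCast]

/-- The determinant equation fixes `z.num` modulo `z.den`, and `0 < z ≤ 1` leaves one
representative. -/
theorem eq_and_eq_of_den_eq {x z x' z' : ℚ} (h : fareyDet x z = 1) (h' : fareyDet x' z' = 1)
    (hx : x.den = x'.den) (hz : z.den = z'.den) (h0 : 0 < z) (h1 : z ≤ 1) (h0' : 0 < z')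
    (h1' : z' ≤ 1) : x = x' ∧ z = z' := by
  unfold fareyDet at h h'
  rw [← hx, ← hz] at h'
  have hq : (0 : ℤ) < z.den := by exact_mod_cast z.den_pos
  have n0 := Rat.num_pos.mpr h0
  have n0' := Rat.num_pos.mpr h0'
  have n1 := ratNum_le_den_iff.mpr h1
  have n1' := ratNum_le_den_iff.mpr h1'
  rw [← hz] at n1'
  have hcop : IsCoprime (z.den : ℤ) (x.den : ℤ) := ⟨-x.num, z.num, by linarith⟩
  have hdvd : (z.den : ℤ) ∣ z.num - z'.num :=
    hcop.dvd_of_dvd_mul_left ⟨x.num - x'.num, by linear_combination h - h'⟩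
  have hz0 : z.num - z'.num = 0 :=
    Int.eq_zero_of_abs_lt_dvd hdvd (by rw [abs_lt]; constructor <;> linarith)
  have hzn : z.num = z'.num := by linarith
  have hxn : x.num = x'.num := by
    have : (z.den : ℤ) * x.num = z.den * x'.num := by
      rw [← hzn] at h'; linarith
    exact mul_left_cancel₀ hq.ne' this
  exact ⟨Rat.ext hxn hx, Rat.ext hzn hz⟩

theorem ncard_fareyPairsGE {Q p j : ℕ} (hp : p.Prime) (hj : 2 ≤ j) :
    (fareyPairsGE Q p j).ncard = (latticePairs Q p j).card := by
  rw [← Set.ncard_coe_finset]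
  have hstruct : ∀ r ∈ fareyPairsGE Q p j, ∃ z ∈ farey Q, fareyDet r.1 z = 1 ∧
      fareyDet z r.2 = 1 ∧ p ∣ z.den ∧ Q < r.1.den + z.den ∧ Q < z.den + r.2.den := fun r hr =>
    exists_between_of_areConsecutive hp hr.1 (by
      have : (2 : ℤ) ≤ j := by exact_mod_cast hj
      exact this.trans hr.2)
  refine Set.ncard_congr
    (fun r _ => ((((r.1.den : ℤ) + r.2.den) / fareyDet r.1 r.2).toNat, r.1.den)) ?_ ?_ ?_
  · rintro ⟨x, y⟩ hr
    obtain ⟨z, hz, hxz, hzy, hpz, hQ1, hQ2⟩ := hstruct _ hr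
    obtain ⟨⟨hx, hy, -, -⟩, hdet⟩ := hr
    dsimp only at *
    rw [den_add_den_div_fareyDet hxz hzy]
    simp only [latticePairs, Finset.coe_filter, Finset.mem_product, Finset.mem_Ioc,
      Set.mem_ofPred_eq]
    refine ⟨⟨⟨z.den_pos, hz.2.2⟩, x.den_pos, hx.1.2.2⟩, hpz, ?_, by omega, ?_⟩
    · rw [← Nat.isCoprime_iff_coprime]
      exact ⟨-x.num, z.num, by unfold fareyDet at hxz; linarith⟩
    · have e := den_mul_fareyDet x y z
      rw [hxz, hzy, mul_one, mul_one] at e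
      have hyQ : (y.den : ℤ) ≤ Q := by exact_mod_cast hy.1.2.2
      have hzp : (0 : ℤ) ≤ z.den := by positivity
      have : (j : ℤ) * z.den ≤ Q + x.den := by nlinarith
      exact_mod_cast this
  · rintro ⟨x, y⟩ ⟨x', y'⟩ hr hr' heq
    obtain ⟨z, hz, hxz, hzy, -⟩ := hstruct _ hr
    obtain ⟨z', hz', hxz', hzy', -⟩ := hstruct _ hr'
    dsimp only at *
    rw [den_add_den_div_fareyDet hxz hzy, den_add_den_div_fareyDet hxz' hzy', Prod.mk.injEq] at heq
    have hlt : x < z := fareyDet_pos_iff.mp (by rw [hxz]; norm_num)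
    have hlt' : x' < z' := fareyDet_pos_iff.mp (by rw [hxz']; norm_num)
    obtain ⟨rfl, -⟩ := eq_and_eq_of_den_eq hxz hxz' heq.2 heq.1
      (hr.1.1.1.1.trans_lt hlt) hz.2.1 (hr'.1.1.1.1.trans_lt hlt') hz'.2.1
    exact congrArg (Prod.mk x) (hr.1.right_unique hr'.1)
  · rintro ⟨q, m⟩ hqm
    simp only [latticePairs, Finset.coe_filter, Finset.mem_product, Finset.mem_Ioc,
      Set.mem_ofPred_eq] at hqm
    obtain ⟨⟨⟨hq0, hqQ⟩, hm0, hmQ⟩, hpq, hcop, hQ, hjq⟩ := hqm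
    have hq0' : (0 : ℤ) < q := by exact_mod_cast hq0
    have hm0' : (0 : ℤ) < m := by exact_mod_cast hm0
    obtain ⟨a, a', haa, ha0, ha1⟩ := exists_mul_sub_mul_eq_one hq0'
      (Nat.isCoprime_iff_coprime.mpr hcop.symm) 0
    rw [zero_add] at ha1
    obtain ⟨z, hza, hzq⟩ := exists_rat_num_den (a := a) hq0' ⟨m, -a', by linarith⟩
    obtain ⟨x, hxa, hxm⟩ := exists_rat_num_den (a := a') hm0' ⟨-q, a, by linarith⟩
    have hzq' : z.den = q := by exact_mod_cast hzq
    have hxm' : x.den = m := by exact_mod_cast hxm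
    have hxz : fareyDet x z = 1 := by rw [fareyDet, hza, hxa, hxm, hzq]; linarith
    have hlt : x < z := fareyDet_pos_iff.mp (by rw [hxz]; norm_num)
    have hx0 : 0 ≤ x := by
      rw [← Rat.num_nonneg, hxa]
      by_contra hneg
      nlinarith
    have hz1 : z ≤ 1 := by rw [← ratNum_le_den_iff, hza, hzq]; exact ha1
    have hz1' : z < 1 := by
      refine lt_of_le_of_ne hz1 ?_
      rintro rfl
      rw [← hzq'] at hpq
      exact hp.one_lt.ne' (Nat.dvd_one.mp hpq)
    have hz : z ∈ farey Q := ⟨hx0.trans hlt.le, hz1, by omega⟩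
    obtain ⟨y, hy, hzy, hQ2⟩ := exists_farey_succ hz hz1'
    have hcons := areConsecutive_of_between (p := p) hp ⟨hx0, hlt.le.trans hz1, by omega⟩ hy hxz hzy
      (by rwa [hzq']) (by omega) hQ2
    refine ⟨(x, y), ⟨hcons, ?_⟩, ?_⟩
    · dsimp only
      have e := den_mul_fareyDet x y z
      rw [hxz, hzy, mul_one, mul_one] at e
      have c1 : (Q : ℤ) < z.den + y.den := by exact_mod_cast hQ2
      have c2 : (j : ℤ) * q ≤ Q + m := by exact_mod_cast hjq
      rw [hzq] at e c1
      rw [hxm] at e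
      -- As `y.den > Q - q`, one has `(fareyDet x y + 1) q > Q + m ≥ j q`.
      by_contra hlt
      have : fareyDet x y + 1 ≤ j := by omega
      nlinarith
    · dsimp only
      rw [den_add_den_div_fareyDet hxz hzy, hzq', hxm']

/-! ### The total number of fractions. -/

/-- Every element except the maximum has exactly one successor. -/
theorem ncard_areConsecutive_add_one {S : Set ℚ} (hS : S.Finite) (hne : S.Nonempty) :
    {r : ℚ × ℚ | AreConsecutive S r.1 r.2}.ncard + 1 = S.ncard := by
  obtain ⟨M, hM, hmax⟩ := Set.exists_max_image S id hS hne
  rw [← Set.ncard_sdiff_singleton_add_one hM hS]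
  congr 1
  refine Set.ncard_congr (fun r _ => r.1) ?_ ?_ ?_
  · rintro ⟨x, y⟩ ⟨hx, hy, hxy, -⟩
    refine ⟨hx, ?_⟩
    rintro rfl
    exact absurd (hmax y hy) (not_le.mpr hxy)
  · rintro ⟨x, y⟩ ⟨x', y'⟩ h h' heq
    dsimp only at heq
    subst heq
    exact congrArg (Prod.mk x) (AreConsecutive.right_unique h h')
  · rintro x ⟨hx, hxM⟩
    have hlt : x < M := lt_of_le_of_ne (hmax x hx) hxM
    obtain ⟨y, ⟨hy, hxy⟩, hmin⟩ := Set.exists_min_image {y | y ∈ S ∧ x < y} id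
      (hS.subset fun _ h => h.1) ⟨M, hM, hlt⟩
    exact ⟨(x, y), ⟨hx, hy, hxy, fun z hz h => absurd (hmin z ⟨hz, h.1⟩) (not_le.mpr h.2)⟩, rfl⟩

theorem one_mem_fareyPrimeTo {Q p : ℕ} (hp : p.Prime) (hQ : 1 ≤ Q) : (1 : ℚ) ∈ fareyPrimeTo Q p :=
  ⟨⟨zero_le_one, le_rfl, hQ⟩, fun h => hp.one_lt.ne' (Nat.dvd_one.mp h)⟩

theorem fareyPairsGE_finite (Q p j : ℕ) : (fareyPairsGE Q p j).Finite :=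
  ((fareyPrimeTo_finite Q p).prod (fareyPrimeTo_finite Q p)).subset
    fun _ hr => ⟨hr.1.1, hr.1.2.1⟩

theorem ncard_fareyPairs_add (Q p k : ℕ) :
    (fareyPairs Q p k).ncard + (fareyPairsGE Q p (k + 1)).ncard = (fareyPairsGE Q p k).ncard := by
  rw [← Set.ncard_union_eq _ (fareyPairs_finite Q p k) (fareyPairsGE_finite Q p (k + 1))]
  · congr 1
    ext r
    simp only [fareyPairs, fareyPairsGE, Set.mem_union, Set.mem_ofPred_eq]
    push_cast
    rw [← and_or_left]
    refine and_congr_right fun _ => ?_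
    omega
  · rw [Set.disjoint_left]
    rintro r ⟨-, h1⟩ ⟨-, h2⟩
    push_cast at h2
    omega

theorem ncard_fareyPairsGE_one_add {Q p : ℕ} (hp : p.Prime) (hQ : 1 ≤ Q) :
    (fareyPairsGE Q p 1).ncard + 1 = (fareyPrimeTo Q p).ncard := by
  rw [← ncard_areConsecutive_add_one (fareyPrimeTo_finite Q p) ⟨1, one_mem_fareyPrimeTo hp hQ⟩]
  congr 2
  ext r
  simp only [fareyPairsGE, Set.mem_ofPred_eq, and_iff_left_iff_imp]
  intro h
  exact fareyDet_pos_iff.mpr h.2.2.1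

theorem ncard_fareyPrimeTo {Q p : ℕ} (hp : p.Prime) (hQ : 1 ≤ Q) :
    (fareyPrimeTo Q p).ncard =
      (∑ q ∈ (Finset.Ioc 0 Q).filter (fun q => ¬ p ∣ q), q.totient) + 1 := by
  rw [← Set.ncard_sdiff_singleton_add_one (one_mem_fareyPrimeTo hp hQ) (fareyPrimeTo_finite Q p)]
  congr 1
  -- The fraction 1 is set aside, so numerators run over `a < q`; for `q = 1` the single term `a =
  -- 0` accounts for the fraction 0.
  have : (∑ q ∈ (Finset.Ioc 0 Q).filter (fun q => ¬ p ∣ q), q.totient) =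
      (((Finset.Ioc 0 Q).filter (fun q => ¬ p ∣ q)).sigma
        fun q => (Finset.range q).filter (fun a => Nat.Coprime q a)).card := by
    rw [Finset.card_sigma]; rfl
  rw [this, ← Set.ncard_coe_finset]
  refine Set.ncard_congr (fun x _ => ⟨x.den, x.num.toNat⟩) ?_ ?_ ?_
  · rintro x ⟨⟨⟨h0, h1, hxQ⟩, hpx⟩, hx1⟩
    have n0 := Rat.num_nonneg.mpr h0
    have n1 := ratNum_lt_den_iff.mpr (lt_of_le_of_ne h1 hx1)
    simp only [Finset.coe_sigma, Set.mem_sigma_iff, Finset.mem_coe, Finset.mem_filter,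
      Finset.mem_Ioc, Finset.mem_range]
    refine ⟨⟨⟨x.den_pos, hxQ⟩, hpx⟩, by omega, ?_⟩
    have := x.reduced.symm
    rwa [← Int.toNat_of_nonneg n0, Int.natAbs_natCast] at this
  · rintro x y ⟨⟨⟨hx0, -⟩, -⟩, -⟩ ⟨⟨⟨hy0, -⟩, -⟩, -⟩ h
    simp only [Sigma.mk.injEq, heq_eq_eq] at h
    have n0 := Rat.num_nonneg.mpr hx0
    have n0' := Rat.num_nonneg.mpr hy0
    exact Rat.ext (by omega) h.1
  · rintro ⟨q, a⟩ h
    simp only [Finset.coe_sigma, Set.mem_sigma_iff, Finset.mem_coe, Finset.mem_filter,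
      Finset.mem_Ioc, Finset.mem_range] at h
    obtain ⟨⟨⟨hq0, hqQ⟩, hpq⟩, haq, hcop⟩ := h
    obtain ⟨x, hxa, hxq⟩ := exists_rat_num_den (a := a) (q := q) (by exact_mod_cast hq0)
      (Nat.isCoprime_iff_coprime.mpr hcop.symm)
    have hxq' : x.den = q := by exact_mod_cast hxq
    have hx1 : x < 1 := by rw [← ratNum_lt_den_iff, hxa, hxq]; exact_mod_cast haq
    refine ⟨x, ⟨⟨⟨?_, hx1.le, by omega⟩, by rwa [hxq']⟩, hx1.ne⟩, ?_⟩
    · rw [← Rat.num_nonneg, hxa]; positivity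
    · simp only [hxq', hxa, Int.toNat_natCast]

theorem cast_ncard_fareyPrimeTo {Q p : ℕ} (hp : p.Prime) (hQ : 1 ≤ Q) :
    ((fareyPrimeTo Q p).ncard : ℝ) = totientSum 1 Q - totientSum p Q + 1 := by
  rw [ncard_fareyPrimeTo hp hQ, totientSum, totientSum]
  push_cast
  have h := Finset.sum_filter_add_sum_filter_not (Finset.Ioc 0 Q) (p ∣ ·)
    (fun q => (q.totient : ℝ))
  simp only [one_dvd, Finset.filter_true]
  linarith

theorem abs_ncard_fareyPrimeTo_sub_le {Q p : ℕ} (hp : p.Prime) (hQ : 1 ≤ Q) :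
    |((fareyPrimeTo Q p).ncard : ℝ) - moebiusConst * p / (2 * (p + 1)) * Q ^ 2| ≤
      1 + Q * (4 * (3 + Real.log Q) + 2 * moebiusConst) := by
  have hc := moebiusConst_pos
  have hp0 : (0 : ℝ) < p := by exact_mod_cast hp.pos
  have hQ0 : (0 : ℝ) ≤ Q := Nat.cast_nonneg Q
  have h1 := abs_totientSum_sub_le hc.le
    (fun x h0 h1 => abs_totientRatioSum_one_sub_le (Q := Q) h0 h1) hQ0 le_rfl
  have h2 := abs_totientSum_sub_le (by positivity : 0 ≤ moebiusConst / (p + 1))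
    (fun x h0 h1 => abs_totientRatioSum_prime_sub_le (Q := Q) hp h0 h1) hQ0 le_rfl
  have hγ : moebiusConst / (p + 1) ≤ moebiusConst := div_le_self hc.le (by linarith)
  rw [Nat.floor_natCast] at h1 h2
  rw [cast_ncard_fareyPrimeTo hp hQ]
  have e : moebiusConst * p / (2 * (p + 1)) * (Q : ℝ) ^ 2 =
      moebiusConst * Q ^ 2 / 2 - moebiusConst / (p + 1) * Q ^ 2 / 2 := by
    field_simp; ring
  rw [e]
  have h3 := mul_le_mul_of_nonneg_left hγ hQ0
  rw [abs_le] at h1 h2 ⊢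
  constructor <;> linarith

/-! ### Passing to proportions. -/

/-- If `A L ≤ c Q / 2`, the denominator is at least `c Q² / 2` and the errors can be divided by it.
Otherwise the claimed bound exceeds 1 and is trivial. -/
theorem abs_div_sub_le_of_abs_sub_le {D M r δ c A Q L : ℝ} (hc : 0 < c) (hA : 0 < A) (hQ : 0 < Q)
    (hL : 0 < L) (hD : 1 ≤ D) (hM0 : 0 ≤ M) (hMD : M ≤ D) (hr0 : 0 ≤ r) (hr1 : r ≤ 1)
    (hδ : c ≤ δ) (h1 : |D - δ * Q ^ 2| ≤ A * (Q * L)) (h2 : |M - r * δ * Q ^ 2| ≤ A * (Q * L)) :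
    |M / D - r| ≤ 4 * A / c * (L / Q) := by
  have hD0 : 0 < D := by linarith
  rcases le_or_gt (A * L) (c / 2 * Q) with h | h
  · have hDl : c / 2 * Q ^ 2 ≤ D := by
      have a1 := (abs_le.mp h1).1
      have a2 : A * (Q * L) ≤ c / 2 * Q ^ 2 := by nlinarith
      have a3 : c * Q ^ 2 ≤ δ * Q ^ 2 := by gcongr
      linarith
    have e : M / D - r = (M - r * D) / D := by field_simp
    have hnum : |M - r * D| ≤ 2 * A * (Q * L) := by
      have a0 : M - r * D = (M - r * δ * Q ^ 2) - r * (D - δ * Q ^ 2) := by ring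
      rw [a0]
      refine (abs_sub _ _).trans ?_
      rw [abs_mul, abs_of_nonneg hr0]
      have := mul_le_mul hr1 h1 (abs_nonneg _) zero_le_one
      linarith
    rw [e, abs_div, abs_of_pos hD0]
    calc _ ≤ 2 * A * (Q * L) / (c / 2 * Q ^ 2) := by gcongr
      _ = _ := by field_simp; ring
  · have a1 : |M / D - r| ≤ 1 := by
      have b1 : M / D ≤ 1 := (div_le_one hD0).mpr hMD
      have b2 : 0 ≤ M / D := by positivity
      rw [abs_le]; constructor <;> linarith
    refine a1.trans ?_
    rw [div_mul_div_comm, one_le_div (by positivity)]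
    nlinarith

theorem half_lt_log_natCast {Q : ℕ} (hQ : 2 ≤ Q) : 1 / 2 < Real.log Q := by
  have h1 := Real.log_two_gt_d9
  have h2 : Real.log 2 ≤ Real.log Q := Real.log_le_log (by norm_num) (by exact_mod_cast hQ)
  linarith

/-- The proportions of consecutive pairs with determinant at least `j`, and the reciprocal of the
number of fractions, up to `O(log Q / Q)`. -/
theorem exists_forall_abs_pairsGE_div_sub_le :
    ∃ B : ℝ, 0 < B ∧ ∀ p : ℕ, p.Prime → ∀ Q : ℕ, 2 ≤ Q →
      1 / ((fareyPrimeTo Q p).ncard : ℝ) ≤ B * (Real.log Q / Q) ∧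
      ∀ j : ℕ, 2 ≤ j → |((fareyPairsGE Q p j).ncard : ℝ) / (fareyPrimeTo Q p).ncard -
        4 / (p * (j * (j + 1)))| ≤ B * (Real.log Q / Q) := by
  have hc := moebiusConst_pos
  set c := moebiusConst with hcdef
  -- `100 + 10 c` generously covers both counting errors once `log Q > 1/2` absorbs constants; `c /
  -- 3` is the value of `c p / (2 (p + 1))` at `p = 2`, its minimum over primes.
  refine ⟨4 * (100 + 10 * c) / (c / 3), by positivity, fun p hp Q hQ => ?_⟩
  have hp2 : (2 : ℝ) ≤ p := by exact_mod_cast hp.two_le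
  have hQ2 : (2 : ℝ) ≤ Q := by exact_mod_cast hQ
  have hL := half_lt_log_natCast hQ
  set L := Real.log Q with hLdef
  have hQL : (1 : ℝ) ≤ Q * L := by nlinarith
  have hcQL : (Q : ℝ) * c ≤ 2 * (c * (Q * L)) := by
    have : 0 ≤ (Q : ℝ) * c := by positivity
    nlinarith
  have hcQL0 : 0 < c * (Q * L) := by positivity
  have hQQL : (Q : ℝ) ≤ 2 * (Q * L) := by nlinarith
  have hδ : c / 3 ≤ c * p / (2 * (p + 1)) := by
    rw [div_le_div_iff₀ (by norm_num) (by positivity)]; nlinarith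
  have hD1 : 1 ≤ (fareyPrimeTo Q p).ncard := by
    rw [← ncard_fareyPairsGE_one_add hp (by omega)]; omega
  have hD1' : (1 : ℝ) ≤ (fareyPrimeTo Q p).ncard := by exact_mod_cast hD1
  have hD := abs_ncard_fareyPrimeTo_sub_le hp (by omega : 1 ≤ Q)
  have hD' : |((fareyPrimeTo Q p).ncard : ℝ) - c * p / (2 * (p + 1)) * Q ^ 2| ≤
      (100 + 10 * c) * (Q * L) := by
    refine hD.trans ?_
    linarith
  have hA : 0 < 100 + 10 * c := by positivity
  have hQ0 : (0 : ℝ) < Q := by linarith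
  have hL0 : 0 < L := by linarith
  constructor
  -- The reciprocal of the count is the case of numerator 1 and limiting ratio 0.
  · have := abs_div_sub_le_of_abs_sub_le (by positivity : 0 < c / 3) hA hQ0 hL0 hD1' zero_le_one hD1'
      le_rfl zero_le_one hδ hD' (M := 1) (r := 0) (by
        rw [zero_mul, zero_mul, sub_zero, abs_one]; linarith)
    rw [sub_zero] at this
    exact (le_abs_self _).trans this
  · intro j hj
    have hj2 : (2 : ℝ) ≤ j := by exact_mod_cast hj
    have hMD : (fareyPairsGE Q p j).ncard ≤ (fareyPrimeTo Q p).ncard := by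
      rw [← ncard_fareyPairsGE_one_add hp (by omega)]
      refine (Set.ncard_le_ncard ?_ (fareyPairsGE_finite Q p 1)).trans (Nat.le_succ _)
      rintro r ⟨h1, h2⟩
      exact ⟨h1, le_trans (by push_cast; omega) h2⟩
    refine abs_div_sub_le_of_abs_sub_le (by positivity) hA hQ0 hL0 hD1' (by positivity)
      (by exact_mod_cast hMD) (by positivity) ?_ hδ hD' ?_
    · rw [div_le_one (by positivity)]
      have : (2 : ℝ) ≤ j * (j + 1) := by nlinarith
      nlinarith
    · have h := abs_card_latticePairs_sub_le hj (by positivity : 0 ≤ c / (p + 1))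
        (fun x h0 h1 => abs_totientRatioSum_prime_sub_le (Q := Q) hp h0 h1)
      rw [ncard_fareyPairsGE hp hj]
      have e : 4 / ((p : ℝ) * (j * (j + 1))) * (c * p / (2 * (p + 1))) * (Q : ℝ) ^ 2 =
          2 * (c / (p + 1)) * Q ^ 2 / (j * (j + 1)) := by
        field_simp; ring
      rw [e]
      refine h.trans ?_
      have hγ : (Q : ℝ) * (c / (p + 1)) ≤ Q * c := by
        gcongr; exact div_le_self hc.le (by linarith)
      rw [← hLdef]
      linarith

theorem corollary1 :
    ∃ C : ℝ, 0 < C ∧ ∀ p : ℕ, p.Prime → ∀ Q : ℕ, 2 ≤ Q →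
      |fareyRho Q p 1 - (1 - 2 / (3 * (p : ℝ)))| ≤ C * (Real.log (Q : ℝ) ^ 2 / (Q : ℝ)) ∧
      ∀ k : ℕ, 2 ≤ k →
        |fareyRho Q p k - 8 / (p : ℝ) * (1 / ((k : ℝ) * ((k : ℝ) + 1) * ((k : ℝ) + 2)))|
          ≤ C * (Real.log (Q : ℝ) ^ 2 / (Q : ℝ)) := by
  obtain ⟨B, hB, h⟩ := exists_forall_abs_pairsGE_div_sub_le
  -- Each case uses two estimates with constant `B`, and `log Q ≤ 2 log² Q` for `Q ≥ 2`.
  refine ⟨4 * B, by positivity, fun p hp Q hQ => ?_⟩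
  obtain ⟨h1, h2⟩ := h p hp Q hQ
  have hp0 : (0 : ℝ) < p := by exact_mod_cast hp.pos
  have hQ0 : (0 : ℝ) < Q := by exact_mod_cast (by omega : 0 < Q)
  have hlog := half_lt_log_natCast hQ
  have hbound : 2 * (B * (Real.log Q / Q)) ≤ 4 * B * (Real.log Q ^ 2 / Q) := by
    have : Real.log Q ≤ 2 * Real.log Q ^ 2 := by nlinarith
    calc _ = 2 * B / Q * Real.log Q := by ring
      _ ≤ 2 * B / Q * (2 * Real.log Q ^ 2) := by gcongr
      _ = _ := by ring
  have hD : ((fareyPairsGE Q p 1).ncard : ℝ) + 1 = (fareyPrimeTo Q p).ncard := by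
    exact_mod_cast ncard_fareyPairsGE_one_add hp (by omega : 1 ≤ Q)
  have hD0 : (0 : ℝ) < (fareyPrimeTo Q p).ncard := by rw [← hD]; positivity
  have hsplit : ∀ k, ((fareyPairs Q p k).ncard : ℝ) =
      (fareyPairsGE Q p k).ncard - (fareyPairsGE Q p (k + 1)).ncard := fun k => by
    rw [← ncard_fareyPairs_add Q p k]; push_cast; ring
  constructor
  · have h3 := h2 2 le_rfl
    -- The extra `1 / ncard` appears because there is one fewer consecutive pair than fractions.
    have e : fareyRho Q p 1 - (1 - 2 / (3 * (p : ℝ))) =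
        -(((fareyPairsGE Q p 2).ncard : ℝ) / (fareyPrimeTo Q p).ncard -
          4 / (p * ((2 : ℕ) * ((2 : ℕ) + 1)))) - 1 / ((fareyPrimeTo Q p).ncard : ℝ) := by
      rw [fareyRho, hsplit 1, eq_sub_of_add_eq hD]
      push_cast
      field_simp
      ring
    rw [e]
    refine (abs_sub _ _).trans (le_trans ?_ hbound)
    rw [abs_neg, abs_of_pos (by positivity : 0 < 1 / ((fareyPrimeTo Q p).ncard : ℝ))]
    linarith
  · intro k hk
    have h3 := h2 k hk
    have h4 := h2 (k + 1) (by omega)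
    have hk0 : (0 : ℝ) < k := by exact_mod_cast (by omega : 0 < k)
    have e : fareyRho Q p k - 8 / (p : ℝ) * (1 / ((k : ℝ) * ((k : ℝ) + 1) * ((k : ℝ) + 2))) =
        (((fareyPairsGE Q p k).ncard : ℝ) / (fareyPrimeTo Q p).ncard - 4 / (p * (k * (k + 1)))) -
        (((fareyPairsGE Q p (k + 1)).ncard : ℝ) / (fareyPrimeTo Q p).ncard -
          4 / (p * ((k + 1 : ℕ) * ((k + 1 : ℕ) + 1)))) := by
      rw [fareyRho, hsplit k]
      push_cast
      field_simp
      ring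
    rw [e]
    refine (abs_sub _ _).trans (le_trans ?_ hbound)
    linarith
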